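/- Let $\lambda$ be an infinite regular cardinal, and let $E^{\lambda^+}_\lambda=\{\beta<\lambda^+ \mid \mathrm{cf}(\beta)=\lambda\}$. Suppose that the proxy principle $\mathrm P^-_\lambda(\lambda^+,2,\sqsubseteq^*,\lambda,\{E^{\lambda^+}_\lambda\})$ holds, that is, there is a sequence $\langle C_\alpha\mid\alpha<\lambda^+\rangle$ such that: - for every nonzero limit ordinal $\alpha<\lambda^+$, $C_\alpha$ is a closed unbounded subset of $\alpha$ of order type at most $\lambda$; - for every sequence $\langle B_i\mid i<\lambda\rangle$ of cofinal subsets of $\lambda^+$, there are stationarily many $\alpha\in E^{\lambda^+}_\lambda$ such that, for all $i<\lambda$, $$\sup\{\delta\in B_i\cap\alpha\mid \min(C_\alpha\setminus(\delta+1))\in B_i\}=\alpha.$$ Then there are a set $T\subseteq E^{\lambda^+}_\lambda$ and a ladder system $\langle L_\alpha\mid\alpha\in T\rangle$ (each $L_\alpha$ is a cofinal subset of $\alpha$ of order type $\mathrm{cf}(\alpha)=\lambda$) such that the corresponding ladder-system space $\mathbb X=(\lambda^+,\tau)$, in which a set $U\subseteq\lambda^+$ is open iff for every $\alpha\in U\cap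 T$ there is $\epsilon<\alpha$ with $L_\alpha\setminus\epsilon\subseteq U$, is a Dowker space, i.e., $\mathbb X$ is Hausdorff and normal, but $\mathbb X\times[0,1]$ is not normal. Moreover, if $\lambda$ is uncountable, then the square $\mathbb X\times\mathbb X$ of this same space is normal. -/

import Mathlib

universe u

open Cardinal Ordinal Order Set

/-! Throughout, a cardinal `κ` is regarded as a set of ordinals via the well-ordered type
`κ.ord.ToType`, whose elements correspond to the ordinals below `κ`. -/

/-- `E^κ_χ`: the set of all `β < κ` of cofinality `χ`. -/
def cofSet (κ χ : Cardinal.{u}) : Set κ.ord.ToType :=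
  {β | Order.cof (Iio β) = χ}

section WellOrder

variable {X : Type u} [LinearOrder X]

/-- `C` is a closed and unbounded subset of (the set of predecessors of) `α`. -/
structure IsClubIn (C : Set X) (α : X) : Prop where
  subset : C ⊆ Iio α
  isClub : IsClub {β : Iio α | (β : X) ∈ C}

/-- `A ⊆* B`: either `A = ∅` or `A \ α ⊆ B` for some `α ∈ A`. -/
def AlmostSubset (A B : Set X) : Prop :=
  A = ∅ ∨ ∃ α ∈ A, A ∩ Ici α ⊆ B

/-- `⟨L_α ∣ α ∈ T⟩` is a ladder system over `T`: every `L_α` is a cofinal subset of `α`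
of order type `cf(α)`. -/
structure IsLadderSystem [WellFoundedLT X] {T : Set X} (L : T → Set X) : Prop where
  subset : ∀ α : T, L α ⊆ Iio (α : X)
  cofinal : ∀ α : T, ∀ β < (α : X), ∃ γ ∈ L α, β ≤ γ
  type_eq : ∀ α : T, typeLT (L α) = (Order.cof (Iio (α : X))).ord

/-- The underlying set of the ladder-system space determined by `L`. -/
def LadderSpace {T : Set X} (_L : T → Set X) : Type u := X

/-- The ladder-system topology: `U` is open iff `L_α ⊆* U` for every `α ∈ U` that carries
a ladder. -/
instance LadderSpace.instTopologicalSpace {T : Set X} (L : T → Set X) :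
    TopologicalSpace (LadderSpace L) where
  IsOpen (U : Set X) := ∀ α : T, (α : X) ∈ U → AlmostSubset (L α) U
  isOpen_univ := by
    intro α _
    rcases (L α).eq_empty_or_nonempty with h | ⟨β, hβ⟩
    · exact Or.inl h
    · exact Or.inr ⟨β, hβ, subset_univ _⟩
  isOpen_inter := by
    intro U V hU hV α hα
    rcases hU α hα.1 with h | ⟨β, hβ, hβU⟩
    · exact Or.inl h
    rcases hV α hα.2 with h | ⟨γ, hγ, hγV⟩
    · exact Or.inl h
    rcases le_total β γ with h | h
    · exact Or.inr ⟨γ, hγ, fun x hx => ⟨hβU ⟨hx.1, h.trans hx.2⟩, hγV hx⟩⟩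
    · exact Or.inr ⟨β, hβ, fun x hx => ⟨hβU hx, hγV ⟨hx.1, h.trans hx.2⟩⟩⟩
  isOpen_sUnion := by
    intro s hs α hα
    obtain ⟨U, hU, hαU⟩ := hα
    rcases hs U hU α hαU with h | ⟨β, hβ, hβU⟩
    · exact Or.inl h
    · exact Or.inr ⟨β, hβ, hβU.trans (subset_sUnion_of_mem hU)⟩

end WellOrder

/-- The proxy principle `P⁻_ξ(κ, 2, ⊑*, θ, 𝒮)`: there is a sequence `⟨C_α ∣ α < κ⟩` such that
* for every limit `α < κ`, `C_α` is a club in `α` of order type at most `ξ`;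
* for every `S ∈ 𝒮` and every sequence `⟨B_i ∣ i < θ⟩` of cofinal subsets of `κ`, there are
  stationarily many `α ∈ S` such that, for all `i < θ`,
  `sup {δ ∈ B_i ∩ α ∣ min (C_α \ (δ + 1)) ∈ B_i} = α`. -/
def ProxyPrinciple (ξ : Ordinal.{u}) (κ θ : Cardinal.{u}) (𝒮 : Set (Set κ.ord.ToType)) : Prop :=
  ∃ C : κ.ord.ToType → Set κ.ord.ToType,
    (∀ α, IsSuccLimit α → IsClubIn (C α) α ∧ typeLT (C α) ≤ ξ) ∧
    ∀ S ∈ 𝒮, ∀ B : θ.ord.ToType → Set κ.ord.ToType, (∀ i, IsCofinal (B i)) →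
      IsStationary {α | α ∈ S ∧
        ∀ i, IsLUB {δ | δ ∈ B i ∧ δ < α ∧ ∃ γ ∈ B i, IsLeast (C α ∩ Ioi δ) γ} α}

/-- A Dowker space: a normal Hausdorff space whose product with the unit interval is not normal. -/
structure IsDowkerSpace (X : Type u) [TopologicalSpace X] : Prop where
  t2 : T2Space X
  normal : NormalSpace X
  not_normal_prod : ¬ NormalSpace (X × unitInterval)

/-! Write `μ` for λ. The points where `C` guesses are split into levels `h = n`, for n in ℕ, each
still guessing (`GuessesOn.exists_level`). With an enumeration `d` of pairs, the ladder at α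
consists of the points x of lower level that are coordinates of `d γ`, where γ is the least element
of `C α` above x. Guessing sparse sets of codes shows that, for any `μ` many families of pairs, each
unbounded in levels below n, some α of level n captures pairs from every family cofinally in its
ladder. `GuessingLadder` isolates this property.

An unbounded closed set is already unbounded below some level, because `μ⁺` has uncountable
cofinality. Hence two unbounded closed sets share a point, and of two disjoint closed sets one is
bounded. Bounded closed sets are separated because bounded families of ladders can be made disjoint
by trimming, so the space is normal. The sets `{x | n ≤ h x}` are closed, unbounded, decreasing and
have empty intersection. Open supersets of them are co-bounded, so these have nonempty intersection,
and the product with the interval is not normal.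

In the square, closed sets unbounded in both coordinates meet on the diagonal. This leaves strips;
there uncountability of `μ` makes the set of unbounded sections closed
(`isClosed_unbounded_sections`), and the rest lies in a box of size at most `μ`. -/

open scoped Topology

/-! ### Separation criteria and Dowker's test for products with the interval. -/

section Separation

variable {Z : Type u} [TopologicalSpace Z]

/-- Separation may be checked on a clopen set and on its complement. -/
theorem SeparatedNhds.of_isClopen {A B K : Set Z} (hK : IsClopen K)
    (h₁ : SeparatedNhds (A ∩ K) (B ∩ K)) (h₂ : SeparatedNhds (A \ K) (B \ K)) :
    SeparatedNhds A B := by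
  obtain ⟨U, V, hU, hV, hAU, hBV, hUV⟩ := h₁
  obtain ⟨U', V', hU', hV', hAU', hBV', hUV'⟩ := h₂
  refine ⟨(U ∩ K) ∪ (U' \ K), (V ∩ K) ∪ (V' \ K), (hU.inter hK.isOpen).union
    (hU'.sdiff hK.isClosed), (hV.inter hK.isOpen).union (hV'.sdiff hK.isClosed), ?_, ?_, ?_⟩
  · intro x hx
    by_cases hxK : x ∈ K
    · exact Or.inl ⟨hAU ⟨hx, hxK⟩, hxK⟩
    · exact Or.inr ⟨hAU' ⟨hx, hxK⟩, hxK⟩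
  · intro x hx
    by_cases hxK : x ∈ K
    · exact Or.inl ⟨hBV ⟨hx, hxK⟩, hxK⟩
    · exact Or.inr ⟨hBV' ⟨hx, hxK⟩, hxK⟩
  · rw [Set.disjoint_left] at *
    rintro x (⟨h1, h2⟩ | ⟨h1, h2⟩) (⟨h3, h4⟩ | ⟨h3, h4⟩)
    · exact hUV h1 h3
    · exact h4 h2
    · exact h2 h4
    · exact hUV' h1 h3

/-- In a regular space in which fewer than `μ` neighbourhoods intersect in a neighbourhood,
disjoint closed sets of size at most `μ` are separated. -/
theorem SeparatedNhds.of_mk_le [RegularSpace Z] {μ : Cardinal.{u}}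
    (hadd : ∀ z : Z, CardinalInterFilter (𝓝 z) μ) (hμ : ℵ₀ ≤ μ) {A B : Set Z}
    (hA : IsClosed A) (hB : IsClosed B) (hAB : Disjoint A B) (hAμ : #A ≤ μ) (hBμ : #B ≤ μ) :
    SeparatedNhds A B := by
  have key : ∀ {A B : Set Z}, IsClosed B → Disjoint A B → ∀ a : A, ∃ U : Set Z,
      IsOpen U ∧ (a : Z) ∈ U ∧ Disjoint (closure U) B := by
    intro A B hB hAB a
    have : Bᶜ ∈ 𝓝 (a : Z) := hB.isOpen_compl.mem_nhds (Set.disjoint_left.1 hAB a.2)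
    obtain ⟨t, ht, htc, htB⟩ := exists_mem_nhds_isClosed_subset this
    refine ⟨interior t, isOpen_interior, mem_interior_iff_mem_nhds.2 ht, ?_⟩
    exact Set.disjoint_left.2 fun x hx hxB => htB (closure_minimal interior_subset htc hx) hxB
  have emb : ∀ {A : Set Z}, #A ≤ μ → ∃ e : A → μ.ord.ToType, Function.Injective e := by
    intro A h
    have : #A ≤ #μ.ord.ToType := by simpa using h
    obtain ⟨e⟩ := this
    exact ⟨e, e.injective⟩
  have small : ∀ {A : Set Z} (e : A → μ.ord.ToType), Function.Injective e → ∀ i,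
      #{a | e a ≤ i} < μ := by
    intro A e he i
    have h1 : #{a | e a ≤ i} ≤ #(Iic i) :=
      Cardinal.mk_le_of_injective (f := fun a => (⟨e a.1, a.2⟩ : Iic i))
        fun a b hab => Subtype.ext (he (congrArg Subtype.val hab))
    refine h1.trans_lt ?_
    rw [← Iio_insert]
    refine (mk_insert_le).trans_lt (add_lt_of_lt hμ ?_ (one_lt_aleph0.trans_le hμ))
    simpa using mk_Iio_lt i (by simp)
  have opn : ∀ {A : Set Z} (e : A → μ.ord.ToType), Function.Injective e → ∀ (i) (V : A → Set Z),
      IsOpen {z | ∀ a ∈ {a | e a ≤ i}, z ∉ closure (V a)} := by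
    intro A e he i V
    rw [isOpen_iff_mem_nhds]
    intro z hz
    have := hadd z
    refine (Filter.eventually_cardinal_ball (p := fun z a _ => z ∉ closure (V a)) (small e he i)).2 ?_
    intro a ha
    exact isClosed_closure.isOpen_compl.mem_nhds (hz a ha)
  choose U hUo hUm hUd using key hB hAB
  choose V hVo hVm hVd using key hA hAB.symm
  obtain ⟨e, he⟩ := emb hAμ
  obtain ⟨f, hf⟩ := emb hBμ
  -- As for regular Lindelöf spaces: each neighbourhood drops the closures of the opposing ones
  -- indexed no later. These are fewer than `μ`, so it stays open.
  refine ⟨⋃ a, U a ∩ {z | ∀ b ∈ {b | f b ≤ e a}, z ∉ closure (V b)},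
    ⋃ b, V b ∩ {z | ∀ a ∈ {a | e a ≤ f b}, z ∉ closure (U a)},
    isOpen_iUnion fun a => (hUo a).inter (opn f hf _ _),
    isOpen_iUnion fun b => (hVo b).inter (opn e he _ _), ?_, ?_, ?_⟩
  · intro a ha
    exact mem_iUnion.2 ⟨⟨a, ha⟩, hUm _, fun b _ hab => Set.disjoint_left.1 (hVd b) hab ha⟩
  · intro b hb
    exact mem_iUnion.2 ⟨⟨b, hb⟩, hVm _, fun a _ hab => Set.disjoint_left.1 (hUd a) hab hb⟩
  · rw [Set.disjoint_left]
    intro z hz hz'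
    obtain ⟨a, ha, ha'⟩ := mem_iUnion.1 hz
    obtain ⟨b, hb, hb'⟩ := mem_iUnion.1 hz'
    rcases le_total (e a) (f b) with h | h
    · exact hb' a h (subset_closure ha)
    · exact ha' b h (subset_closure hb)

/-- If the product with the unit interval is normal, then decreasing closed sets with empty
intersection expand to open sets with empty intersection. -/
theorem exists_isOpen_iInter_eq_empty_of_normal_prod [NormalSpace (Z × unitInterval)]
    (D : ℕ → Set Z) (hD : ∀ n, IsClosed (D n)) (hanti : Antitone D) (hempty : ⋂ n, D n = ∅) :
    ∃ U : ℕ → Set Z, (∀ n, IsOpen (U n)) ∧ (∀ n, D n ⊆ U n) ∧ ⋂ n, U n = ∅ := by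
  let t : ℕ → unitInterval := fun n => ⟨1 / ((n : ℝ) + 1), by positivity,
    by rw [div_le_one (by positivity)]; linarith [Nat.cast_nonneg (α := ℝ) n]⟩
  have ht : Filter.Tendsto t Filter.atTop (𝓝 0) := by
    rw [tendsto_subtype_rng]
    exact tendsto_one_div_add_atTop_nhds_zero_nat
  have htlt : ∀ m n, t n < t m → m < n := by
    intro m n hmn
    by_contra! hle
    have : (t m : ℝ) ≤ t n := one_div_le_one_div_of_le (by positivity) (by exact_mod_cast by omega)
    exact absurd hmn (not_lt.2 this)
  -- `W` contains the bottom edge since the `D n` have empty intersection, and misses `(x, t n)` for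
  -- x in `D n` since the `D n` decrease. Separating the edge from `Wᶜ` and slicing at height `t n`
  -- gives `U n`.
  let W : Set (Z × unitInterval) := ⋃ n, (D n)ᶜ ×ˢ Iio (t n)
  have hW : IsOpen W := isOpen_iUnion fun n => (hD n).isOpen_compl.prod isOpen_Iio
  have hA : IsClosed (Set.univ ×ˢ {0} : Set (Z × unitInterval)) :=
    isClosed_univ.prod isClosed_singleton
  have hdisj : Disjoint (Set.univ ×ˢ {0} : Set (Z × unitInterval)) Wᶜ := by
    rw [Set.disjoint_left]
    rintro ⟨x, s⟩ ⟨-, hs⟩ hW'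
    apply hW'
    have : x ∉ ⋂ n, D n := by simp [hempty]
    obtain ⟨n, hn⟩ := by simpa using this
    refine mem_iUnion.2 ⟨n, hn, ?_⟩
    rw [mem_singleton_iff.1 hs]
    change (0 : ℝ) < 1 / ((n : ℝ) + 1)
    positivity
  obtain ⟨V, G, hV, hG, hAV, hWG, hVG⟩ := normal_separation hA hW.isClosed_compl hdisj
  refine ⟨fun n => {x | (x, t n) ∈ G}, fun n => hG.preimage (by fun_prop), ?_, ?_⟩
  · intro n x hx
    apply hWG
    intro hW'
    obtain ⟨m, hm, hlt⟩ := mem_iUnion.1 hW'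
    exact hm (hanti (htlt m n hlt).le hx)
  · rw [eq_empty_iff_forall_notMem]
    intro x hx
    have h1 : Filter.Tendsto (fun n => (x, t n)) Filter.atTop (𝓝 (x, (0 : unitInterval))) :=
      tendsto_const_nhds.prodMk_nhds ht
    have h2 := h1.eventually (hV.mem_nhds (hAV ⟨mem_univ _, rfl⟩))
    obtain ⟨n, hn⟩ := h2.exists
    exact Set.disjoint_left.1 hVG hn (mem_iInter.1 hx n)

end Separation

/-! ### Guessing ladders: basic topology and the meeting of unbounded closed sets. -/

/-- A ladder-system topology on a well-order of size `μ⁺`, with a level function `h` that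
strictly decreases along ladders, such that any `μ` many families of pairs that are unbounded
in the levels below `n` are simultaneously captured by the ladder of some point of level `n`. -/
structure GuessingLadder (μ : Cardinal.{u}) {Z : Type u} [LinearOrder Z] [TopologicalSpace Z]
    (T : Set Z) (L : Z → Set Z) (h : Z → ℕ) : Prop where
  regular : μ.IsRegular
  isOpen_iff : ∀ U : Set Z, IsOpen U ↔ ∀ α ∈ T, α ∈ U → ∃ ε < α, ∀ x ∈ L α, ε < x → x ∈ U
  lt_of_mem : ∀ α ∈ T, ∀ x ∈ L α, x < α
  mk_inter_Iio_lt : ∀ α ∈ T, ∀ ε < α, #(L α ∩ Iio ε : Set Z) < μ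
  bounded_below : ∀ α ∈ T, ∀ s ⊆ Iio α, #s < μ → ∃ ε < α, ∀ x ∈ s, x ≤ ε
  bounded : ∀ s : Set Z, #s ≤ μ → ∃ ε, ∀ x ∈ s, x ≤ ε
  mk_Iic_le : ∀ β : Z, #(Iic β) ≤ μ
  level_lt : ∀ α ∈ T, ∀ x ∈ L α, h x < h α
  guess : ∀ (n : ℕ) (ι : Type u) [Nonempty ι] (P : ι → Set (Z × Z)), #ι ≤ μ →
    (∀ i ε, ∃ p ∈ P i, ε < p.1 ∧ ε < p.2 ∧ h p.1 < n ∧ h p.2 < n) →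
    ∀ ε, ∃ α ∈ T, ε < α ∧ h α = n ∧
      ∀ i, ∀ ε < α, ∃ p ∈ P i, ε < p.1 ∧ ε < p.2 ∧ p.1 ∈ L α ∧ p.2 ∈ L α
  exists_level : ∀ (n : ℕ) (ε : Z), ∃ α, ε < α ∧ n ≤ h α

namespace GuessingLadder

variable {μ : Cardinal.{u}} {Z : Type u} [LinearOrder Z] [TopologicalSpace Z]
  {T : Set Z} {L : Z → Set Z} {h : Z → ℕ}

theorem isOpen_Iic (H : GuessingLadder μ T L h) (β : Z) : IsOpen (Iic β) := by
  rw [H.isOpen_iff]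
  intro α hα hαβ
  -- The empty set is bounded below α, which merely supplies some point below α.
  obtain ⟨ε, hε, -⟩ := H.bounded_below α hα ∅ (empty_subset _) (by simpa using H.regular.pos)
  exact ⟨ε, hε, fun x hx _ => (H.lt_of_mem α hα x hx).le.trans hαβ⟩

theorem isOpen_Ioi (H : GuessingLadder μ T L h) (β : Z) : IsOpen (Ioi β) := by
  rw [H.isOpen_iff]
  exact fun α _ hαβ => ⟨β, hαβ, fun x _ hx => hx⟩

theorem isClopen_Iic (H : GuessingLadder μ T L h) (β : Z) : IsClopen (Iic β) :=
  ⟨⟨by rw [compl_Iic]; exact H.isOpen_Ioi β⟩, H.isOpen_Iic β⟩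

theorem isClopen_Ioi (H : GuessingLadder μ T L h) (β : Z) : IsClopen (Ioi β) := by
  rw [← compl_Iic]
  exact (H.isClopen_Iic β).compl

theorem t1Space (H : GuessingLadder μ T L h) : T1Space Z := by
  refine ⟨fun x => ⟨?_⟩⟩
  rw [H.isOpen_iff]
  intro α hα hαx
  rcases lt_or_gt_of_ne (show α ≠ x from hαx) with hlt | hlt
  · obtain ⟨ε, hε, -⟩ := H.bounded_below α hα ∅ (empty_subset _) (by simpa using H.regular.pos)
    exact ⟨ε, hε, fun y hy _ => ((H.lt_of_mem α hα y hy).trans hlt).ne⟩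
  · exact ⟨x, hlt, fun y _ hy => hy.ne'⟩

theorem exists_mem_ladder_of_mem_nhds (H : GuessingLadder μ T L h) {α : Z} (hα : α ∈ T)
    {U : Set Z} (hU : U ∈ 𝓝 α) : ∃ ε < α, ∀ x ∈ L α, ε < x → x ∈ U := by
  obtain ⟨V, hVU, hV, hαV⟩ := mem_nhds_iff.1 hU
  obtain ⟨ε, hε, hεV⟩ := (H.isOpen_iff V).1 hV α hα hαV
  exact ⟨ε, hε, fun x hx hx' => hVU (hεV x hx hx')⟩

/-- A closed set which meets a ladder in a cofinal set contains its top. -/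
theorem mem_of_isClosed (H : GuessingLadder μ T L h) {F : Set Z} (hF : IsClosed F) {α : Z}
    (hα : α ∈ T) (hcof : ∀ ε < α, ∃ x ∈ F, ε < x ∧ x ∈ L α) : α ∈ F := by
  by_contra hαF
  obtain ⟨ε, hε, hεF⟩ := H.exists_mem_ladder_of_mem_nhds hα (hF.isOpen_compl.mem_nhds hαF)
  obtain ⟨x, hxF, hεx, hx⟩ := hcof ε hε
  exact hεF x hx hεx hxF

theorem diag_mem_of_isClosed (H : GuessingLadder μ T L h) {F : Set (Z × Z)} (hF : IsClosed F)
    {α : Z} (hα : α ∈ T)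
    (hcof : ∀ ε < α, ∃ p ∈ F, ε < p.1 ∧ ε < p.2 ∧ p.1 ∈ L α ∧ p.2 ∈ L α) : (α, α) ∈ F := by
  by_contra hαF
  have := hF.isOpen_compl.mem_nhds hαF
  rw [nhds_prod_eq, Filter.mem_prod_same_iff] at this
  obtain ⟨U, hU, hUF⟩ := this
  obtain ⟨ε, hε, hεF⟩ := H.exists_mem_ladder_of_mem_nhds hα hU
  obtain ⟨p, hpF, h1, h2, h3, h4⟩ := hcof ε hε
  exact hUF (mk_mem_prod (hεF _ h3 h1) (hεF _ h4 h2)) hpF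

theorem bounded_seq (H : GuessingLadder μ T L h) (e : ℕ → Z) : ∃ ε, ∀ n, e n ≤ ε := by
  obtain ⟨ε, hε⟩ := H.bounded (range e) ((countable_range e).le_aleph0.trans H.regular.aleph0_le)
  exact ⟨ε, fun n => hε _ (mem_range_self n)⟩

/-- An unbounded set of pairs is unbounded in a bounded set of levels. -/
theorem exists_level_bound (H : GuessingLadder μ T L h) {P : Set (Z × Z)}
    (hP : ∀ ε, ∃ p ∈ P, ε < p.1 ∧ ε < p.2) :
    ∃ n, ∀ ε, ∃ p ∈ P, ε < p.1 ∧ ε < p.2 ∧ h p.1 < n ∧ h p.2 < n := by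
  by_contra! hn
  choose e he using hn
  obtain ⟨ε, hε⟩ := H.bounded_seq e
  obtain ⟨p, hp, h1, h2⟩ := hP ε
  have := he (max (h p.1) (h p.2) + 1) p hp ((hε _).trans_lt h1) ((hε _).trans_lt h2) (by omega)
  omega

/-- Closed subsets of the square which are unbounded in both coordinates intersect. -/
theorem not_disjoint_of_unbounded_prod (H : GuessingLadder μ T L h) {A B : Set (Z × Z)}
    (hA : IsClosed A) (hB : IsClosed B) (hAu : ∀ ε, ∃ p ∈ A, ε < p.1 ∧ ε < p.2)
    (hBu : ∀ ε, ∃ p ∈ B, ε < p.1 ∧ ε < p.2) : ¬ Disjoint A B := by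
  obtain ⟨m, hm⟩ := H.exists_level_bound hAu
  obtain ⟨n, hn⟩ := H.exists_level_bound hBu
  obtain ⟨z, -⟩ := H.bounded ∅ (by simp)
  obtain ⟨α, hα, -, -, hg⟩ := H.guess (max m n) (ULift Bool) (fun i => if i.down then A else B)
    ((lt_aleph0_of_finite _).le.trans H.regular.aleph0_le) (by
      rintro ⟨i⟩ ε
      cases i
      · obtain ⟨p, hp, h1, h2, h3, h4⟩ := hn ε
        exact ⟨p, by simpa using hp, h1, h2, by omega, by omega⟩
      · obtain ⟨p, hp, h1, h2, h3, h4⟩ := hm ε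
        exact ⟨p, by simpa using hp, h1, h2, by omega, by omega⟩) z
  have hαA := H.diag_mem_of_isClosed hA hα (by simpa using hg ⟨true⟩)
  have hαB := H.diag_mem_of_isClosed hB hα (by simpa using hg ⟨false⟩)
  exact Set.not_disjoint_iff.2 ⟨_, hαA, hαB⟩

theorem not_disjoint_of_unbounded (H : GuessingLadder μ T L h) {A B : Set Z}
    (hA : IsClosed A) (hB : IsClosed B) (hAu : ∀ ε, ∃ x ∈ A, ε < x)
    (hBu : ∀ ε, ∃ x ∈ B, ε < x) : ¬ Disjoint A B := by
  intro hAB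
  refine H.not_disjoint_of_unbounded_prod (hA.prod hA) (hB.prod hB) ?_ ?_
    (Disjoint.set_prod_left hAB _ _)
  · intro ε
    obtain ⟨x, hx, hεx⟩ := hAu ε
    exact ⟨(x, x), ⟨hx, hx⟩, hεx, hεx⟩
  · intro ε
    obtain ⟨x, hx, hεx⟩ := hBu ε
    exact ⟨(x, x), ⟨hx, hx⟩, hεx, hεx⟩

/-! ### Separation of bounded closed sets, and normality. -/

/-- Boundedly many ladders can be made pairwise disjoint by removing initial segments. -/
theorem exists_disjointifying (H : GuessingLadder μ T L h) (β : Z) :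
    ∃ f : Z → Z, (∀ α ∈ T, α ≤ β → f α < α) ∧ ∀ α ∈ T, α ≤ β → ∀ α' ∈ T, α' ≤ β →
      ∀ x ∈ L α, x ∈ L α' → f α < x → f α' < x → α = α' := by
  have hle : #(Iic β) ≤ #μ.ord.ToType := by simpa using H.mk_Iic_le β
  obtain ⟨e⟩ := hle
  have key : ∀ α : Z, ∃ ε, α ∈ T → ∀ hαβ : α ≤ β, ε < α ∧ ∀ α' ∈ T, ∀ hα' : α' ≤ β,
      e ⟨α', hα'⟩ < e ⟨α, hαβ⟩ → ∀ x ∈ L α, x ∈ L α' → x ≤ ε := by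
    intro α
    by_cases hα : α ∈ T ∧ α ≤ β
    swap
    · exact ⟨α, fun h1 h2 => absurd ⟨h1, h2⟩ hα⟩
    obtain ⟨hα, hαβ⟩ := hα
    -- Fewer than `μ` ladders precede that of α in the enumeration, and two distinct ladders meet in
    -- fewer than `μ` points, all below the smaller top. By regularity their traces on `L α` are
    -- bounded below α.
    let J : Set (Iic β) := {α' | (α' : Z) ∈ T ∧ e α' < e ⟨α, hαβ⟩}
    have hJ : #J < μ := by
      have h1 : #J ≤ #(Iio (e ⟨α, hαβ⟩)) :=
        Cardinal.mk_le_of_injective (f := fun a => (⟨e a.1, a.2.2⟩ : Iio (e ⟨α, hαβ⟩)))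
          fun a b hab => Subtype.ext (e.injective (congrArg Subtype.val hab))
      refine h1.trans_lt ?_
      simpa using mk_Iio_lt (e ⟨α, hαβ⟩) (by simp)
    have hs : #(⋃ a ∈ J, L α ∩ L (a : Z) : Set Z) < μ := by
      rw [card_biUnion_lt_iff_forall_of_isRegular H.regular hJ]
      rintro ⟨α', hα'β⟩ ⟨hα', hlt⟩
      rcases lt_trichotomy α α' with hlt' | rfl | hlt'
      · refine (mk_le_mk_of_subset ?_).trans_lt (H.mk_inter_Iio_lt α' hα' α hlt')
        exact fun x hx => ⟨hx.2, H.lt_of_mem α hα x hx.1⟩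
      · exact absurd hlt (lt_irrefl _)
      · refine (mk_le_mk_of_subset ?_).trans_lt (H.mk_inter_Iio_lt α hα α' hlt')
        exact fun x hx => ⟨hx.1, H.lt_of_mem α' hα' x hx.2⟩
    obtain ⟨ε, hε, hε'⟩ := H.bounded_below α hα _ (iUnion₂_subset fun a _ x hx =>
      H.lt_of_mem α hα x hx.1) hs
    refine ⟨ε, fun _ _ => ⟨hε, fun α' hα' hα'β hlt x hx hx' => hε' x ?_⟩⟩
    exact mem_iUnion₂.2 ⟨⟨α', hα'β⟩, ⟨hα', hlt⟩, hx, hx'⟩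
  choose f hf using key
  refine ⟨f, fun α hα hαβ => (hf α hα hαβ).1, fun α hα hαβ α' hα' hα'β x hx hx' h1 h2 => ?_⟩
  rcases lt_trichotomy (e ⟨α, hαβ⟩) (e ⟨α', hα'β⟩) with hlt | heq | hlt
  · exact absurd ((hf α' hα' hα'β).2 α hα hαβ hlt x hx' hx) (not_le.2 h2)
  · exact congrArg Subtype.val (e.injective heq)
  · exact absurd ((hf α hα hαβ).2 α' hα' hα'β hlt x hx hx') (not_le.2 h1)

theorem separatedNhds_of_subset_Iic (H : GuessingLadder μ T L h) {A B : Set Z}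
    (hA : IsClosed A) (hB : IsClosed B) (hAB : Disjoint A B) {β : Z} (hAβ : A ⊆ Iic β)
    (hBβ : B ⊆ Iic β) : SeparatedNhds A B := by
  obtain ⟨f, hf, hf'⟩ := H.exists_disjointifying β
  -- `U A B` collects the points that climb to `A` along trimmed ladders, every step starting
  -- outside `B`. Disjointness of the trimmed ladders makes the climb deterministic, so a common
  -- point of `U A B` and `U B A` would follow one path to both sets, crossing a forbidden one.
  let R (B : Set Z) (x α : Z) : Prop := x ∉ B ∧ α ∈ T ∧ α ≤ β ∧ x ∈ L α ∧ f α < x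
  let U (A B : Set Z) : Set Z := {x | ∃ z ∈ A, Relation.ReflTransGen (R B) x z}
  have hle : ∀ {A B : Set Z}, A ⊆ Iic β → U A B ⊆ Iic β := by
    rintro A B hAβ x ⟨z, hz, hxz⟩
    induction hxz using Relation.ReflTransGen.head_induction_on with
    | refl => exact hAβ hz
    | head hxy _ ih => exact ((H.lt_of_mem _ hxy.2.1 _ hxy.2.2.2.1).le.trans hxy.2.2.1)
  have hdisj' : ∀ {A B : Set Z}, Disjoint A B → Disjoint (U A B) B := by
    intro A B hAB
    rw [Set.disjoint_left]
    rintro x ⟨z, hz, hxz⟩ hxB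
    rcases hxz.cases_head with rfl | ⟨y, hy, -⟩
    · exact Set.disjoint_left.1 hAB hz hxB
    · exact hy.1 hxB
  have hopen : ∀ {A B : Set Z}, IsClosed B → Disjoint A B → A ⊆ Iic β → IsOpen (U A B) := by
    intro A B hB hAB hAβ
    rw [H.isOpen_iff]
    intro α hα hαU
    have hαB : α ∉ B := Set.disjoint_left.1 (hdisj' hAB) hαU
    have hαβ : α ≤ β := hle hAβ hαU
    obtain ⟨ε, hε, hεB⟩ := H.exists_mem_ladder_of_mem_nhds hα (hB.isOpen_compl.mem_nhds hαB)
    refine ⟨max ε (f α), max_lt hε (hf α hα hαβ), fun x hx hεx => ?_⟩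
    obtain ⟨z, hz, hαz⟩ := hαU
    exact ⟨z, hz, hαz.head ⟨hεB x hx ((le_max_left _ _).trans_lt hεx), hα, hαβ, hx,
      (le_max_right _ _).trans_lt hεx⟩⟩
  refine ⟨U A B, U B A, hopen hB hAB hAβ, hopen hA hAB.symm hBβ,
    fun x hx => ⟨x, hx, .refl⟩, fun x hx => ⟨x, hx, .refl⟩, ?_⟩
  rw [Set.disjoint_left]
  rintro x ⟨z, hz, hxz⟩
  induction hxz using Relation.ReflTransGen.head_induction_on with
  | refl => exact fun hx => Set.disjoint_left.1 (hdisj' hAB.symm) hx hz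
  | head hxy _ ih =>
    rintro ⟨w, hw, hxw⟩
    rcases hxw.cases_head with rfl | ⟨y', hy', hy'w⟩
    · exact hxy.1 hw
    · obtain ⟨-, h1, h2, h3, h4⟩ := hxy
      obtain ⟨-, h1', h2', h3', h4'⟩ := hy'
      obtain rfl := hf' _ h1 h2 _ h1' h2' _ h3 h3' h4 h4'
      exact ih ⟨w, hw, hy'w⟩

theorem normalSpace (H : GuessingLadder μ T L h) : NormalSpace Z := by
  refine ⟨fun A B hA hB hAB => ?_⟩
  have : ∃ β, A ∩ Ioi β = ∅ ∨ B ∩ Ioi β = ∅ := by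
    by_contra! hne
    refine H.not_disjoint_of_unbounded hA hB (fun ε => ?_) (fun ε => ?_) hAB
    · exact (hne ε).1
    · exact (hne ε).2
  obtain ⟨β, hβ⟩ := this
  refine SeparatedNhds.of_isClopen (H.isClopen_Ioi β) ?_ ?_
  · rcases hβ with hβ | hβ <;> simp [hβ]
  · rw [sdiff_eq, sdiff_eq, compl_Ioi]
    exact H.separatedNhds_of_subset_Iic (hA.inter (H.isClopen_Iic β).isClosed)
      (hB.inter (H.isClopen_Iic β).isClosed) (hAB.mono inter_subset_left inter_subset_left)
      inter_subset_right inter_subset_right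

/-! ### Failure of normality of the product with the interval. -/

theorem isClosed_level (H : GuessingLadder μ T L h) (n : ℕ) : IsClosed {x | n ≤ h x} := by
  refine ⟨(H.isOpen_iff _).2 fun α hα hαn => ?_⟩
  obtain ⟨ε, hε, -⟩ := H.bounded_below α hα ∅ (empty_subset _) (by simpa using H.regular.pos)
  refine ⟨ε, hε, fun x hx _ hxn => hαn ?_⟩
  exact hxn.trans (H.level_lt α hα x hx).le

theorem not_normalSpace_prod (H : GuessingLadder μ T L h) :
    ¬ NormalSpace (Z × unitInterval) := by
  intro hN
  obtain ⟨U, hU, hDU, hempty⟩ := exists_isOpen_iInter_eq_empty_of_normal_prod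
    (fun n => {x | n ≤ h x}) H.isClosed_level (fun m n hmn x hx => hmn.trans hx) (by
      rw [eq_empty_iff_forall_notMem]
      intro x hx
      exact absurd (mem_iInter.1 hx (h x + 1)) (by simp))
  have hb : ∀ n, ∃ ε, ∀ x ∈ (U n)ᶜ, x ≤ ε := by
    intro n
    by_contra! hne
    refine H.not_disjoint_of_unbounded (hU n).isClosed_compl (H.isClosed_level n) hne ?_
      (disjoint_compl_left.mono_right (hDU n))
    intro ε
    obtain ⟨α, h1, h2⟩ := H.exists_level n ε
    exact ⟨α, h2, h1⟩
  choose e he using hb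
  obtain ⟨ε, hε⟩ := H.bounded_seq e
  obtain ⟨α, hα, -⟩ := H.exists_level 0 ε
  have : α ∈ ⋂ n, U n := by
    refine mem_iInter.2 fun n => ?_
    by_contra hn
    exact absurd ((he n α hn).trans (hε n)) (not_le.2 hα)
  simp [hempty] at this

/-! ### Normality of the square. -/

theorem cardinalInterFilter_nhds (H : GuessingLadder μ T L h) (z : Z) :
    CardinalInterFilter (𝓝 z) μ := by
  refine ⟨fun S hS hSz => ?_⟩
  have hopen : IsOpen (⋂ U : S, interior (U : Set Z)) := by
    rw [H.isOpen_iff]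
    intro α hα hαS
    have := fun U : S => (H.isOpen_iff (interior (U : Set Z))).1 isOpen_interior α hα
      (mem_iInter.1 hαS U)
    choose e he he' using this
    obtain ⟨ε, hε, hε'⟩ := H.bounded_below α hα (range e) (range_subset_iff.2 he)
      (mk_range_le.trans_lt hS)
    exact ⟨ε, hε, fun x hx hεx => mem_iInter.2 fun U =>
      he' U x hx ((hε' _ (mem_range_self U)).trans_lt hεx)⟩
  refine Filter.mem_of_superset (hopen.mem_nhds (mem_iInter.2 fun U => ?_)) ?_
  · exact mem_interior_iff_mem_nhds.2 (hSz U U.2)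
  · exact fun x hx U hU => interior_subset (mem_iInter.1 hx ⟨U, hU⟩)

theorem cardinalInterFilter_nhds_prod (H : GuessingLadder μ T L h) (p : Z × Z) :
    CardinalInterFilter (𝓝 p) μ := by
  have := H.cardinalInterFilter_nhds
  rw [← Prod.mk.eta (p := p), nhds_prod_eq, Filter.prod_eq_inf]
  infer_instance

/-- If `μ` is uncountable, then the set of `y` over which a closed subset of the square has an
unbounded section is closed. -/
theorem isClosed_unbounded_sections (H : GuessingLadder μ T L h) (hμ : ℵ₀ < μ)
    {A : Set (Z × Z)} (hA : IsClosed A) : IsClosed {y | ∀ ε, ∃ x, (x, y) ∈ A ∧ ε < x} := by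
  refine ⟨(H.isOpen_iff _).2 fun y hy hyA => ?_⟩
  by_contra! hcof
  apply hyA
  have hlev : ∀ y', ∃ n, (∀ ε, ∃ x, (x, y') ∈ A ∧ ε < x) →
      ∀ ε, ∃ x, (x, y') ∈ A ∧ ε < x ∧ h x < n := by
    intro y'
    by_cases hy' : ∀ ε, ∃ x, (x, y') ∈ A ∧ ε < x
    · obtain ⟨n, hn⟩ := H.exists_level_bound (P := {p | p.1 = p.2 ∧ (p.1, y') ∈ A}) (by
        intro ε
        obtain ⟨x, hx, hεx⟩ := hy' ε
        exact ⟨(x, x), ⟨rfl, hx⟩, hεx, hεx⟩)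
      refine ⟨n, fun _ ε => ?_⟩
      obtain ⟨p, hp, h1, -, h2, -⟩ := hn ε
      exact ⟨p.1, hp.2, h1, h2⟩
    · exact ⟨0, fun hh => absurd hh hy'⟩
  choose N hN using hlev
  -- Countably many bounds below y have a common one as `μ` is uncountable, so a single level bound
  -- serves cofinally many points of the ladder.
  have hn : ∃ n, ∀ ε < y, ∃ x ∈ L y, ε < x ∧ (∀ ε, ∃ x', (x', x) ∈ A ∧ ε < x') ∧ N x = n := by
    by_contra! hne
    choose e he he' using hne
    obtain ⟨ε, hε, hε'⟩ := H.bounded_below y hy (range e) (range_subset_iff.2 he)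
      ((countable_range e).le_aleph0.trans_lt hμ)
    obtain ⟨x, hx, hεx, hxA⟩ := hcof ε hε
    exact he' (N x) x hx ((hε' _ (mem_range_self _)).trans_lt hεx) (not_not.1 hxA) rfl
  obtain ⟨n, hn⟩ := hn
  let Q : Set Z := {x | x ∈ L y ∧ (∀ ε, ∃ x', (x', x) ∈ A ∧ ε < x') ∧ N x = n}
  have hQ : Nonempty Q := by
    obtain ⟨ε, hε, -⟩ := H.bounded_below y hy ∅ (empty_subset _) (by simpa using H.regular.pos)
    obtain ⟨x, hx, -, hx'⟩ := hn ε hε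
    exact ⟨x, hx, hx'⟩
  have hQμ : #Q ≤ μ := (mk_le_mk_of_subset fun x hx =>
    (H.lt_of_mem y hy x hx.1).le).trans (H.mk_Iic_le y)
  intro ε
  -- One α captures the sections over all q in `Q` at once, so `(α, q)` is in `A`. As `Q` is cofinal
  -- in the ladder of y, `(α, y)` is in `A` too.
  obtain ⟨α, hα, hεα, -, hg⟩ := H.guess n Q (fun q => {p | (p.1, (q : Z)) ∈ A ∧ p.1 = p.2}) hQμ (by
    rintro ⟨q, h1, h2, rfl⟩ ε
    obtain ⟨x, hx, hεx, hxn⟩ := hN q h2 ε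
    exact ⟨(x, x), ⟨hx, rfl⟩, hεx, hεx, hxn, hxn⟩) ε
  refine ⟨α, ?_, hεα⟩
  have hαq : ∀ q ∈ Q, (α, q) ∈ A := by
    intro q hq
    refine H.mem_of_isClosed (F := {x | (x, q) ∈ A}) (hA.preimage (by fun_prop)) hα ?_
    intro ε hε
    obtain ⟨p, ⟨hp, -⟩, h1, -, h2, -⟩ := hg ⟨q, hq⟩ ε hε
    exact ⟨p.1, hp, h1, h2⟩
  refine H.mem_of_isClosed (F := {x | (α, x) ∈ A}) (hA.preimage (by fun_prop)) hy ?_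
  intro ε hε
  obtain ⟨x, hx, hεx, hx'⟩ := hn ε hε
  exact ⟨x, hαq x ⟨hx, hx'⟩, hεx, hx⟩

theorem separatedNhds_of_subset_Iic_prod (H : GuessingLadder μ T L h) {A B : Set (Z × Z)}
    (hA : IsClosed A) (hB : IsClosed B) (hAB : Disjoint A B) {η ε : Z}
    (hAs : A ⊆ Iic η ×ˢ Iic ε) (hBs : B ⊆ Iic η ×ˢ Iic ε) : SeparatedNhds A B := by
  have := H.normalSpace
  have := H.t1Space
  have hcard : #(Iic η ×ˢ Iic ε : Set (Z × Z)) ≤ μ := by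
    rw [mk_setProd]
    simpa using (mul_le_mul' (H.mk_Iic_le η) (H.mk_Iic_le ε)).trans
      (mul_eq_self H.regular.aleph0_le).le
  exact SeparatedNhds.of_mk_le H.cardinalInterFilter_nhds_prod H.regular.aleph0_le hA hB hAB
    ((mk_le_mk_of_subset hAs).trans hcard) ((mk_le_mk_of_subset hBs).trans hcard)

/-- There are at most `μ` rows, so the bounded sections have a common bound. Beyond it, `A` and `B`
lie over the disjoint closed sets `S A` and `S B`, which are separated in `Z`; before it, both lie
in a box. -/
theorem separatedNhds_of_subset_univ_prod_Iic (H : GuessingLadder μ T L h) (hμ : ℵ₀ < μ)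
    {A B : Set (Z × Z)} (hA : IsClosed A) (hB : IsClosed B) (hAB : Disjoint A B) {ε : Z}
    (hAs : A ⊆ Set.univ ×ˢ Iic ε) (hBs : B ⊆ Set.univ ×ˢ Iic ε) : SeparatedNhds A B := by
  let S (A : Set (Z × Z)) : Set Z := {y | ∀ ε, ∃ x, (x, y) ∈ A ∧ ε < x}
  have hbd : ∀ A : Set (Z × Z), A ⊆ Set.univ ×ˢ Iic ε → ∃ η, ∀ p ∈ A, η < p.1 → p.2 ∈ S A := by
    intro A hAs
    have : ∀ y, ∃ η, y ∉ S A → ∀ x, (x, y) ∈ A → x ≤ η := by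
      intro y
      by_cases hy : y ∈ S A
      · exact ⟨y, fun hy' => absurd hy hy'⟩
      · simp only [S, mem_ofPred_eq, not_forall, not_exists, not_and, not_lt] at hy
        obtain ⟨η, hη⟩ := hy
        exact ⟨η, fun _ => hη⟩
    choose e he using this
    obtain ⟨η, hη⟩ := H.bounded (e '' Iic ε) (mk_image_le.trans (H.mk_Iic_le ε))
    refine ⟨η, fun p hp hηp => ?_⟩
    by_contra hpS
    exact absurd ((he p.2 hpS p.1 hp).trans (hη _ (mem_image_of_mem e (hAs hp).2))) (not_le.2 hηp)
  obtain ⟨η₁, hη₁⟩ := hbd A hAs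
  obtain ⟨η₂, hη₂⟩ := hbd B hBs
  have hK : IsClopen (Iic (max η₁ η₂) ×ˢ Set.univ : Set (Z × Z)) :=
    (H.isClopen_Iic _).prod isClopen_univ
  refine SeparatedNhds.of_isClopen hK ?_ ?_
  · refine H.separatedNhds_of_subset_Iic_prod (η := max η₁ η₂) (ε := ε) (hA.inter hK.isClosed)
      (hB.inter hK.isClosed) (hAB.mono inter_subset_left inter_subset_left) ?_ ?_
    · exact fun p hp => ⟨hp.2.1, (hAs hp.1).2⟩
    · exact fun p hp => ⟨hp.2.1, (hBs hp.1).2⟩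
  · have hS : Disjoint (S A) (S B) := by
      rw [Set.disjoint_left]
      intro y hyA hyB
      refine H.not_disjoint_of_unbounded (A := {x | (x, y) ∈ A}) (B := {x | (x, y) ∈ B})
        (hA.preimage (by fun_prop)) (hB.preimage (by fun_prop)) hyA hyB ?_
      exact Set.disjoint_left.2 fun x hx hx' => Set.disjoint_left.1 hAB hx hx'
    have := H.normalSpace
    have hsep := normal_separation (H.isClosed_unbounded_sections hμ hA)
      (H.isClosed_unbounded_sections hμ hB) hS
    refine (hsep.preimage (f := Prod.snd) continuous_snd).mono ?_ ?_
    · rintro p ⟨hp, hpK⟩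
      refine hη₁ p hp (not_le.1 fun hle => hpK ⟨?_, mem_univ _⟩)
      exact hle.trans (le_max_left _ _)
    · rintro p ⟨hp, hpK⟩
      refine hη₂ p hp (not_le.1 fun hle => hpK ⟨?_, mem_univ _⟩)
      exact hle.trans (le_max_right _ _)

theorem normalSpace_prod_self (H : GuessingLadder μ T L h) (hμ : ℵ₀ < μ) :
    NormalSpace (Z × Z) := by
  refine ⟨fun A B hA hB hAB => ?_⟩
  have : ∃ ε, A ∩ Ioi ε ×ˢ Ioi ε = ∅ ∨ B ∩ Ioi ε ×ˢ Ioi ε = ∅ := by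
    by_contra! hne
    exact H.not_disjoint_of_unbounded_prod hA hB (fun ε => (hne ε).1) (fun ε => (hne ε).2) hAB
  obtain ⟨ε, hε⟩ := this
  have hK : IsClopen (Ioi ε ×ˢ Ioi ε : Set (Z × Z)) := (H.isClopen_Ioi ε).prod (H.isClopen_Ioi ε)
  have hK' : IsClopen (Set.univ ×ˢ Iic ε : Set (Z × Z)) := isClopen_univ.prod (H.isClopen_Iic ε)
  refine SeparatedNhds.of_isClopen hK ?_ ?_
  · rcases hε with hε | hε <;> simp [hε]
  have hA' : IsClosed (A \ Ioi ε ×ˢ Ioi ε) := hA.sdiff hK.isOpen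
  have hB' : IsClosed (B \ Ioi ε ×ˢ Ioi ε) := hB.sdiff hK.isOpen
  have hAB' := hAB.mono (sdiff_subset (s := A) (t := Ioi ε ×ˢ Ioi ε))
    (sdiff_subset (s := B) (t := Ioi ε ×ˢ Ioi ε))
  refine SeparatedNhds.of_isClopen hK' ?_ ?_
  · exact H.separatedNhds_of_subset_univ_prod_Iic hμ (hA'.inter hK'.isClosed)
      (hB'.inter hK'.isClosed) (hAB'.mono inter_subset_left inter_subset_left)
      inter_subset_right inter_subset_right
  -- Outside the tail square and the horizontal strip, the first coordinate is at most `ε`.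
  · have hswap := H.separatedNhds_of_subset_univ_prod_Iic hμ (ε := ε)
      ((hA'.sdiff hK'.isOpen).preimage continuous_swap)
      ((hB'.sdiff hK'.isOpen).preimage continuous_swap)
      ((hAB'.mono sdiff_subset sdiff_subset).preimage Prod.swap) ?_ ?_
    · simpa [preimage_preimage] using hswap.preimage continuous_swap
    all_goals
      rintro ⟨x, y⟩ ⟨⟨-, h1⟩, h2⟩
      refine ⟨mem_univ _, not_lt.1 fun hlt => h1 ⟨hlt, not_le.1 fun hle => h2 ⟨mem_univ _, hle⟩⟩⟩

theorem isDowkerSpace (H : GuessingLadder μ T L h) : IsDowkerSpace Z := by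
  have := H.normalSpace
  have := H.t1Space
  exact ⟨inferInstance, inferInstance, H.not_normalSpace_prod⟩

end GuessingLadder

/-! ### Order types, cofinality and initial segments. -/

section InitialSegments

variable {X : Type u} [LinearOrder X] {μ : Cardinal.{u}} {s : Set X}

theorem typeLT_le_ord_iff [WellFoundedLT X] : typeLT s ≤ μ.ord ↔ ∀ x : s, #(Iio x) < μ := by
  constructor
  · intro hs x
    have h1 : typein (α := s) (· < ·) x < μ.ord := (typein_lt_type _ x).trans_le hs
    rw [lt_ord, card_typein] at h1
    exact h1
  · intro hs
    by_contra! hlt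
    obtain ⟨x, hx⟩ := typein_surj (α := s) (· < ·) hlt
    have h1 := congrArg Ordinal.card hx
    rw [card_typein, card_ord] at h1
    exact (hs x).ne h1

theorem mk_inter_Iio_eq (x : X) (hx : x ∈ s) : #(s ∩ Iio x : Set X) = #(Iio (⟨x, hx⟩ : s)) :=
  Cardinal.mk_congr
    { toFun := fun y => ⟨⟨y, y.2.1⟩, y.2.2⟩
      invFun := fun y => ⟨y.1, y.1.2, y.2⟩
      left_inv := fun _ => rfl
      right_inv := fun _ => rfl }

theorem mk_inter_Iic_lt [WellFoundedLT X] (hμ : ℵ₀ ≤ μ) (hs : typeLT s ≤ μ.ord) (x : X) (hx : x ∈ s) :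
    #(s ∩ Iic x : Set X) < μ := by
  have h1 : s ∩ Iic x = insert x (s ∩ Iio x) := by
    rw [← Iio_insert, inter_insert_of_mem hx]
  rw [h1]
  refine mk_insert_le.trans_lt (add_lt_of_lt hμ ?_ (one_lt_aleph0.trans_le hμ))
  rw [mk_inter_Iio_eq x hx]
  exact typeLT_le_ord_iff.1 hs _

theorem exists_lt_forall_lt_of_mk_lt_cof {α : X} (hs : s ⊆ Iio α) (hc : #s < Order.cof (Iio α)) :
    ∃ ε < α, ∀ x ∈ s, x < ε := by
  have h1 : ¬ IsCofinal {β : Iio α | (β : X) ∈ s} := by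
    intro hcof
    refine absurd (Order.cof_le hcof) (not_le.2 (lt_of_le_of_lt ?_ hc))
    exact Cardinal.mk_le_of_injective (f := fun β => (⟨β.1.1, β.2⟩ : s))
      fun a b hab => Subtype.ext (Subtype.ext (Subtype.mk.inj hab))
  obtain ⟨ε, hε⟩ := not_isCofinal_iff.1 h1
  exact ⟨ε, ε.2, fun x hx => hε ⟨x, hs hx⟩ hx⟩

theorem isSuccLimit_of_aleph0_le_cof_Iio {α : X} (hα : ℵ₀ ≤ Order.cof (Iio α)) :
    IsSuccLimit α := by
  refine ⟨fun hmin => ?_, fun b hb => ?_⟩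
  · have : IsEmpty (Iio α) := by
      rw [isEmpty_coe_sort, hmin.Iio_eq]
    rw [Order.cof_eq_zero] at hα
    exact absurd hα (not_le.2 aleph0_pos)
  · have h1 : IsCofinal ({⟨b, hb.lt⟩} : Set (Iio α)) := fun x =>
      ⟨_, rfl, not_lt.1 fun hlt => hb.2 hlt x.2⟩
    have h2 := Order.cof_le h1
    rw [mk_singleton] at h2
    exact absurd (hα.trans h2) (not_le.2 one_lt_aleph0)

end InitialSegments

/-! ### Coding pairs, splitting the guessing set, and the coded ladders on `μ⁺`. -/

section SuccessorCardinal

variable {μ : Cardinal.{u}}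

theorem mk_Iic_toType_succ_le (hμ : ℵ₀ ≤ μ) (β : (Order.succ μ).ord.ToType) :
    #(Iic β) ≤ μ := by
  have h1 : #(Iio β) < Order.succ μ := by simpa using mk_Iio_lt β (by simp)
  rw [← Iio_insert]
  refine mk_insert_le.trans ?_
  exact add_le_of_le hμ (lt_succ_iff.1 h1) (one_lt_aleph0.le.trans hμ)

theorem exists_forall_lt_of_mk_le (hμ : ℵ₀ ≤ μ) {s : Set (Order.succ μ).ord.ToType}
    (hs : #s ≤ μ) : ∃ ε, ∀ x ∈ s, x < ε := by
  rw [← not_isCofinal_iff]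
  intro hcof
  have h1 := Order.cof_le hcof
  rw [cof_toType, (isRegular_succ hμ).cof_ord] at h1
  exact absurd (h1.trans hs) (not_le.2 (lt_succ μ))

theorem exists_gt_toType_succ (hμ : ℵ₀ ≤ μ) (ε : (Order.succ μ).ord.ToType) : ∃ x, ε < x := by
  obtain ⟨x, hx⟩ := exists_forall_lt_of_mk_le hμ (s := {ε})
    (by rw [mk_singleton]; exact one_lt_aleph0.le.trans hμ)
  exact ⟨x, hx ε rfl⟩

/-- There is an enumeration of the pairs in which every pair occurs unboundedly often. -/
theorem exists_pair_code (hμ : ℵ₀ ≤ μ) :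
    ∃ d : (Order.succ μ).ord.ToType → (Order.succ μ).ord.ToType × (Order.succ μ).ord.ToType,
      ∀ p ε, ∃ γ, ε < γ ∧ d γ = p := by
  have hsucc : ℵ₀ ≤ Order.succ μ := hμ.trans (le_succ μ)
  have hcard : #(Order.succ μ).ord.ToType = #((Order.succ μ).ord.ToType ×
      ((Order.succ μ).ord.ToType × (Order.succ μ).ord.ToType)) := by
    simp [mul_eq_self hsucc]
  obtain ⟨e⟩ := Cardinal.eq.1 hcard
  refine ⟨fun γ => (e γ).2, fun p ε => ?_⟩
  by_contra! hne
  have h1 : #(Order.succ μ).ord.ToType ≤ #(Iic ε) := by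
    refine Cardinal.mk_le_of_injective (f := fun x => (⟨e.symm (x, p), ?_⟩ : Iic ε)) ?_
    · exact not_lt.1 fun hlt => hne _ hlt (by simp)
    · intro x y hxy
      simpa using congrArg Subtype.val hxy
  have h2 := h1.trans (mk_Iic_toType_succ_le hμ ε)
  rw [mk_toType, card_ord] at h2
  exact absurd h2 (not_le.2 (lt_succ μ))

/-- An unbounded set of pairs is coded along a sparse cofinal set. -/
theorem exists_sparse_coding (hμ : ℵ₀ ≤ μ)
    {d : (Order.succ μ).ord.ToType → (Order.succ μ).ord.ToType × (Order.succ μ).ord.ToType}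
    (hd : ∀ p ε, ∃ γ, ε < γ ∧ d γ = p)
    {P : Set ((Order.succ μ).ord.ToType × (Order.succ μ).ord.ToType)}
    (hP : ∀ ε, ∃ p ∈ P, ε < p.1 ∧ ε < p.2) :
    ∃ B : Set (Order.succ μ).ord.ToType, IsCofinal B ∧ ∀ δ ∈ B, ∀ γ ∈ B, δ < γ →
      d γ ∈ P ∧ δ < (d γ).1 ∧ δ < (d γ).2 ∧ (d γ).1 < γ ∧ (d γ).2 < γ := by
  have hc : ∀ ε, ∃ γ, d γ ∈ P ∧ ε < (d γ).1 ∧ ε < (d γ).2 ∧ (d γ).1 < γ ∧ (d γ).2 < γ := by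
    intro ε
    obtain ⟨p, hp, h1, h2⟩ := hP ε
    obtain ⟨γ, hγ, rfl⟩ := hd p (max p.1 p.2)
    exact ⟨γ, hp, h1, h2, (le_max_left _ _).trans_lt hγ, (le_max_right _ _).trans_lt hγ⟩
  choose c hcP hc1 hc2 hc3 hc4 using hc
  have hb : ∀ (ξ : (Order.succ μ).ord.ToType)
      (F : ∀ η, η < ξ → (Order.succ μ).ord.ToType), ∃ ε, ξ ≤ ε ∧ ∀ η hη, F η hη < ε := by
    intro ξ F
    obtain ⟨ε, hε⟩ := exists_forall_lt_of_mk_le hμ (s := range fun η : Iio ξ => F η η.2)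
      (mk_range_le.trans ((mk_le_mk_of_subset Iio_subset_Iic_self).trans
        (mk_Iic_toType_succ_le hμ ξ)))
    exact ⟨max ξ ε, le_max_left _ _, fun η hη =>
      (hε _ ⟨⟨η, hη⟩, rfl⟩).trans_le (le_max_right _ _)⟩
  choose b hbξ hb using hb
  -- Each new code lies above both coordinates of its pair, and these lie above all earlier codes.
  -- The clause `ξ ≤ ε` makes the range cofinal.
  let g : (Order.succ μ).ord.ToType → (Order.succ μ).ord.ToType :=
    wellFounded_lt.fix fun ξ F => c (b ξ F)
  have hg : ∀ ξ, g ξ = c (b ξ fun η _ => g η) := fun ξ => wellFounded_lt.fix_eq _ ξ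
  have hlt : ∀ η ξ, η < ξ → g η < (d (g ξ)).1 ∧ g η < (d (g ξ)).2 ∧ g η < g ξ := by
    intro η ξ hηξ
    have h1 := hb ξ (fun η _ => g η) η hηξ
    rw [hg ξ]
    exact ⟨h1.trans (hc1 _), h1.trans (hc2 _), h1.trans ((hc1 _).trans (hc3 _))⟩
  refine ⟨range g, fun ξ => ⟨g ξ, mem_range_self ξ, ?_⟩, ?_⟩
  · rw [hg ξ]
    exact (hbξ ξ _).trans ((hc1 _).trans (hc3 _)).le
  · rintro _ ⟨η, rfl⟩ _ ⟨ξ, rfl⟩ hηξ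
    have hηξ' : η < ξ := by
      rcases lt_trichotomy η ξ with h1 | rfl | h1
      · exact h1
      · exact absurd hηξ (lt_irrefl _)
      · exact absurd (hlt ξ η h1).2.2 hηξ.not_gt
    refine ⟨?_, (hlt η ξ hηξ').1, (hlt η ξ hηξ').2.1, ?_, ?_⟩ <;> rw [hg ξ]
    · exact hcP _
    · exact hc3 _
    · exact hc4 _

/-- `C` guesses at points of `S`: any `μ` many cofinal sets are simultaneously hit by consecutive
elements of `C α`, cofinally in `α`, for unboundedly many `α ∈ S`. -/
def GuessesOn (C : (Order.succ μ).ord.ToType → Set (Order.succ μ).ord.ToType)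
    (S : Set (Order.succ μ).ord.ToType) : Prop :=
  ∀ B : μ.ord.ToType → Set (Order.succ μ).ord.ToType, (∀ i, IsCofinal (B i)) →
    ∀ ε, ∃ α ∈ S, ε < α ∧ ∀ i, ∀ ε < α, ∃ δ ∈ B i, ε < δ ∧ ∃ γ ∈ B i, IsLeast (C α ∩ Ioi δ) γ

variable {C : (Order.succ μ).ord.ToType → Set (Order.succ μ).ord.ToType}
  {S : Set (Order.succ μ).ord.ToType}

theorem guessesOn_of_isStationary (hμ : ℵ₀ ≤ μ)
    (hS : ∀ B : μ.ord.ToType → Set (Order.succ μ).ord.ToType, (∀ i, IsCofinal (B i)) →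
      IsStationary {α | α ∈ S ∧
        ∀ i, IsLUB {δ | δ ∈ B i ∧ δ < α ∧ ∃ γ ∈ B i, IsLeast (C α ∩ Ioi δ) γ} α}) :
    GuessesOn C S := by
  intro B hB ε
  have hclub : IsClub (Ioi ε) := by
    refine ⟨fun s hs hne _ a ha => ?_, fun x => ?_⟩
    · obtain ⟨x, hx⟩ := hne
      exact lt_of_lt_of_le (hs hx) (ha.1 hx)
    · obtain ⟨y, hy⟩ := exists_gt_toType_succ hμ (max ε x)
      exact ⟨y, (le_max_left _ _).trans_lt hy, ((le_max_right _ _).trans_lt hy).le⟩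
  obtain ⟨α, ⟨hαS, hα⟩, hεα⟩ := hS B hB hclub
  refine ⟨α, hαS, hεα, fun i ε' hε' => ?_⟩
  obtain ⟨δ, ⟨hδ, -, hγ⟩, hεδ⟩ := (lt_isLUB_iff (hα i)).1 hε'
  exact ⟨δ, hδ, hεδ, hγ⟩

/-- The sets on which `C` does not guess form a `μ⁺`-complete ideal. -/
theorem GuessesOn.exists_of_iUnion (hμ : ℵ₀ ≤ μ)
    {A : μ.ord.ToType → Set (Order.succ μ).ord.ToType} (hA : GuessesOn C (⋃ j, A j)) :
    ∃ j, GuessesOn C (A j) := by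
  by_contra hne
  have hne' : ∀ j, ∃ B : μ.ord.ToType → Set (Order.succ μ).ord.ToType,
      (∀ i, IsCofinal (B i)) ∧ ∃ ε, ∀ α ∈ A j, ε < α → ¬ ∀ i, ∀ ε < α, ∃ δ ∈ B i, ε < δ ∧
        ∃ γ ∈ B i, IsLeast (C α ∩ Ioi δ) γ := by
    intro j
    by_contra hj
    refine hne ⟨j, fun B hB ε => ?_⟩
    by_contra hα
    exact hj ⟨B, hB, ε, fun α h1 h2 h3 => hα ⟨α, h1, h2, h3⟩⟩
  choose B hB ε hε using hne'
  -- The `μ` many counterexample sequences merge into one of length `μ`, which the union must guess.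
  have hcard : #μ.ord.ToType = #(μ.ord.ToType × μ.ord.ToType) := by simp [mul_eq_self hμ]
  obtain ⟨e⟩ := Cardinal.eq.1 hcard
  obtain ⟨ε', hε'⟩ := exists_forall_lt_of_mk_le hμ (s := range ε) (mk_range_le.trans (by simp))
  obtain ⟨α, hα, hlt, hg⟩ := hA (fun i => B (e i).1 (e i).2) (fun i => hB _ _) ε'
  obtain ⟨j, hj⟩ := mem_iUnion.1 hα
  refine hε j α hj ((hε' _ (mem_range_self j)).trans hlt) fun i => ?_
  simpa using hg (e.symm (j, i))

/-- A set on which `C` guesses splits into infinitely many such sets (by an Ulam matrix). -/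
theorem GuessesOn.exists_level (hμ : ℵ₀ ≤ μ) (hS : GuessesOn C S) :
    ∃ h : (Order.succ μ).ord.ToType → ℕ, ∀ n, GuessesOn C {α | α ∈ S ∧ h α = n} := by
  have hemb : ∀ α : (Order.succ μ).ord.ToType, Nonempty (Iic α ↪ μ.ord.ToType) := by
    intro α
    have h1 : #(Iic α) ≤ #μ.ord.ToType := by simpa using mk_Iic_toType_succ_le hμ α
    exact h1
  let f (α) := Classical.choice (hemb α)
  let A (η : (Order.succ μ).ord.ToType) (i : μ.ord.ToType) : Set (Order.succ μ).ord.ToType :=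
    {α | α ∈ S ∧ ∃ hη : η ≤ α, f α ⟨η, hη⟩ = i}
  have hA : ∀ η, ∃ i, GuessesOn C (A η i) := by
    intro η
    refine GuessesOn.exists_of_iUnion hμ fun B hB ε => ?_
    obtain ⟨α, hα, hlt, hg⟩ := hS B hB (max ε η)
    refine ⟨α, mem_iUnion.2 ⟨f α ⟨η, ((le_max_right _ _).trans_lt hlt).le⟩, hα, _, rfl⟩,
      (le_max_left _ _).trans_lt hlt, hg⟩
  choose i hi using hA
  -- Infinitely many rows share a column `j`; sets in one column are disjoint since each `f α` is
  -- injective.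
  obtain ⟨j, hj⟩ := infinite_pigeonhole_card_lt i (by simp)
    (by simpa using hμ.trans (le_succ μ))
  have hinf : Infinite (i ⁻¹' {j}) := by
    rw [Cardinal.infinite_iff]
    exact le_trans (by simpa using hμ) hj.le
  let η : ℕ ↪ i ⁻¹' {j} := Infinite.natEmbedding _
  have hdisj : ∀ m n α, α ∈ A (η m) j → α ∈ A (η n) j → m = n := by
    rintro m n α ⟨-, h1, h2⟩ ⟨-, h3, h4⟩
    have h5 := (f α).injective (h2.trans h4.symm)
    exact η.injective (Subtype.ext (Subtype.mk.inj h5))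
  classical
  let h : (Order.succ μ).ord.ToType → ℕ := fun α =>
    -- The default only enlarges level 0, and guessing passes to supersets.
    if hα : ∃ n, α ∈ A (η n) j then hα.choose else 0
  refine ⟨h, fun n B hB ε => ?_⟩
  have hn : GuessesOn C (A (η n) j) := by
    have h1 := hi (η n)
    rwa [show i (η n) = j from (η n).2] at h1
  obtain ⟨α, hα, hlt, hg⟩ := hn B hB ε
  refine ⟨α, ⟨hα.1, ?_⟩, hlt, hg⟩
  have hex : ∃ n, α ∈ A (η n) j := ⟨n, hα⟩
  simp only [h, dif_pos hex]
  exact hdisj _ _ α hex.choose_spec hα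

/-- The ladder at `α`: the elements of lower level which are coded by the next element
of `C α`. -/
def codedLadder (C : (Order.succ μ).ord.ToType → Set (Order.succ μ).ord.ToType)
    (d : (Order.succ μ).ord.ToType → (Order.succ μ).ord.ToType × (Order.succ μ).ord.ToType)
    (h : (Order.succ μ).ord.ToType → ℕ) (α : (Order.succ μ).ord.ToType) :
    Set (Order.succ μ).ord.ToType :=
  {x | h x < h α ∧ ∃ γ, IsLeast (C α ∩ Ioi x) γ ∧ (x = (d γ).1 ∨ x = (d γ).2)}

variable {d : (Order.succ μ).ord.ToType → (Order.succ μ).ord.ToType × (Order.succ μ).ord.ToType}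
  {h : (Order.succ μ).ord.ToType → ℕ} {α : (Order.succ μ).ord.ToType}

theorem codedLadder_subset (hC : IsClubIn (C α) α) : codedLadder C d h α ⊆ Iio α := by
  rintro x ⟨-, γ, hγ, -⟩
  exact mem_Iio.2 (lt_trans (mem_Ioi.1 hγ.1.2) (mem_Iio.1 (hC.subset hγ.1.1)))

/-- If `γ₀ ≥ ε` is in `C α`, points below `ε` are coded by elements of `C α` up to `γ₀`. There are
fewer than `μ` of these, each coding at most two points. -/
theorem mk_codedLadder_inter_Iio_lt (hμ : ℵ₀ ≤ μ) (hC : IsClubIn (C α) α)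
    (htype : typeLT (C α) ≤ μ.ord) {ε : (Order.succ μ).ord.ToType} (hε : ε < α) :
    #(codedLadder C d h α ∩ Iio ε : Set _) < μ := by
  obtain ⟨⟨γ₀, hγ₀α⟩, hγ₀, hle⟩ := hC.isClub.isCofinal ⟨ε, hε⟩
  have hsub : codedLadder C d h α ∩ Iio ε ⊆
      (fun γ => (d γ).1) '' (C α ∩ Iic γ₀) ∪ (fun γ => (d γ).2) '' (C α ∩ Iic γ₀) := by
    rintro x ⟨⟨-, γ, hγ, hx⟩, hxε⟩
    have hγle : γ ≤ γ₀ := hγ.2 ⟨hγ₀, mem_Ioi.2 ((mem_Iio.1 hxε).trans_le (Subtype.coe_le_coe.2 hle))⟩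
    rcases hx with hx | hx
    · exact Or.inl ⟨γ, ⟨hγ.1.1, hγle⟩, hx.symm⟩
    · exact Or.inr ⟨γ, ⟨hγ.1.1, hγle⟩, hx.symm⟩
  have hlt := mk_inter_Iic_lt hμ htype γ₀ hγ₀
  exact (mk_le_mk_of_subset hsub).trans_lt ((mk_union_le _ _).trans_lt
    (add_lt_of_lt hμ (mk_image_le.trans_lt hlt) (mk_image_le.trans_lt hlt)))

theorem typeLT_codedLadder (hμ : ℵ₀ ≤ μ) (hC : IsClubIn (C α) α)
    (htype : typeLT (C α) ≤ μ.ord) (hα : Order.cof (Iio α) = μ)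
    (hcof : ∀ ε < α, ∃ x ∈ codedLadder C d h α, ε < x) :
    typeLT (codedLadder C d h α) = μ.ord := by
  refine le_antisymm (typeLT_le_ord_iff.2 fun x => ?_) ?_
  · rw [← mk_inter_Iio_eq x.1 x.2]
    exact mk_codedLadder_inter_Iio_lt hμ hC htype (codedLadder_subset hC x.2)
  · rw [ord_le, card_type]
    by_contra! hlt
    obtain ⟨ε, hε, hε'⟩ := exists_lt_forall_lt_of_mk_lt_cof (codedLadder_subset hC)
      (hlt.trans_eq hα.symm)
    obtain ⟨x, hx, hεx⟩ := hcof ε hε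
    exact absurd (hε' x hx) hεx.not_gt

end SuccessorCardinal

/-! ### The ladder-system topology and the main theorem. -/

section LadderSpace

variable {X : Type u} [LinearOrder X] {T : Set X}

instance LadderSpace.instLinearOrder (L : T → Set X) : LinearOrder (LadderSpace L) :=
  inferInstanceAs (LinearOrder X)

theorem almostSubset_iff_of_cofinal {A U : Set X} {α : X} (hA : A ⊆ Iio α)
    (hcof : ∀ ε < α, ∃ x ∈ A, ε < x) (hα : ∃ ε, ε < α) :
    AlmostSubset A U ↔ ∃ ε < α, ∀ x ∈ A, ε < x → x ∈ U := by
  constructor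
  · rintro (rfl | ⟨β, hβ, hβU⟩)
    · obtain ⟨ε, hε⟩ := hα
      obtain ⟨x, hx, -⟩ := hcof ε hε
      exact absurd hx (notMem_empty x)
    · exact ⟨β, hA hβ, fun x hx hβx => hβU ⟨hx, hβx.le⟩⟩
  · rintro ⟨ε, hε, hεU⟩
    obtain ⟨β, hβ, hεβ⟩ := hcof ε hε
    exact Or.inr ⟨β, hβ, fun x hx => hεU x hx.1 (hεβ.trans_le hx.2)⟩

end LadderSpace

theorem mainTheorem11 (μ : Cardinal.{u}) (hμ : μ.IsRegular)
    (hP : ProxyPrinciple μ.ord (Order.succ μ) μ {cofSet (Order.succ μ) μ}) :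
    ∃ (T : Set (Order.succ μ).ord.ToType) (L : T → Set (Order.succ μ).ord.ToType),
      T ⊆ cofSet (Order.succ μ) μ ∧ IsLadderSystem L ∧
      IsDowkerSpace (LadderSpace L) ∧
      (ℵ₀ < μ → NormalSpace (LadderSpace L × LadderSpace L)) := by
  have hω := hμ.aleph0_le
  obtain ⟨C, hC, hguess⟩ := hP
  obtain ⟨h, hh⟩ := (guessesOn_of_isStationary hω (hguess _ rfl)).exists_level hω
  obtain ⟨d, hd⟩ := exists_pair_code hω
  have hlim : ∀ α ∈ cofSet (Order.succ μ) μ, IsSuccLimit α := fun α hα =>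
    isSuccLimit_of_aleph0_le_cof_Iio (hω.trans (Eq.ge hα))
  -- Points whose coded ladder is not cofinal get no ladder and are isolated.
  let T : Set (Order.succ μ).ord.ToType :=
    {α | α ∈ cofSet (Order.succ μ) μ ∧ ∀ ε < α, ∃ x ∈ codedLadder C d h α, ε < x}
  let L : T → Set (Order.succ μ).ord.ToType := fun α => codedLadder C d h α
  have hclub : ∀ α ∈ T, IsClubIn (C α) α := fun α hα => (hC α (hlim α hα.1)).1
  have htype : ∀ α ∈ T, typeLT (C α) ≤ μ.ord := fun α hα => (hC α (hlim α hα.1)).2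
  have H : GuessingLadder (Z := LadderSpace L) μ T (codedLadder C d h) h :=
    { regular := hμ
      isOpen_iff := by
        intro U
        have key : ∀ α (hα : α ∈ T), AlmostSubset (L ⟨α, hα⟩) U ↔
            ∃ ε < α, ∀ x ∈ codedLadder C d h α, ε < x → x ∈ U := fun α hα =>
          almostSubset_iff_of_cofinal (codedLadder_subset (hclub α hα)) hα.2
            (by simpa using (hlim α hα.1).1)
        exact ⟨fun hU α hα hαU => (key α hα).1 (hU ⟨α, hα⟩ hαU),
          fun hU α hαU => (key α α.2).2 (hU α.1 α.2 hαU)⟩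
      lt_of_mem := fun α hα x hx => codedLadder_subset (hclub α hα) hx
      mk_inter_Iio_lt := fun α hα ε hε =>
        mk_codedLadder_inter_Iio_lt hω (hclub α hα) (htype α hα) hε
      bounded_below := by
        intro α hα s hs hsμ
        obtain ⟨ε, hε, hε'⟩ := exists_lt_forall_lt_of_mk_lt_cof
          (X := (Order.succ μ).ord.ToType) hs (hsμ.trans_eq (Eq.symm hα.1))
        exact ⟨ε, hε, fun x hx => (hε' x hx).le⟩
      bounded := by
        intro s hs
        obtain ⟨ε, hε⟩ := exists_forall_lt_of_mk_le hω hs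
        exact ⟨ε, fun x hx => (hε x hx).le⟩
      mk_Iic_le := mk_Iic_toType_succ_le hω
      level_lt := fun α _ x hx => hx.1
      guess := by
        intro n ι _ P hι hP ε
        have hι' : #ι ≤ #μ.ord.ToType := by simpa using hι
        obtain ⟨e⟩ := hι'
        -- Only pairs of level below n are coded, as the ladder of a level n point admits no others.
        have hB := fun i => exists_sparse_coding hω hd (P := P i ∩ {p | h p.1 < n ∧ h p.2 < n}) (by
          intro ε
          obtain ⟨p, hp, h1, h2, h3⟩ := hP i ε
          exact ⟨p, ⟨hp, h3⟩, h1, h2⟩)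
        choose B hBcof hB using hB
        obtain ⟨α, ⟨hαS, hαn⟩, hεα, hg⟩ := hh n (fun j => B (Function.invFun e j))
          (fun j => hBcof _) ε
        have hcap : ∀ i, ∀ ε < α, ∃ p ∈ P i, ε < p.1 ∧ ε < p.2 ∧
            p.1 ∈ codedLadder C d h α ∧ p.2 ∈ codedLadder C d h α := by
          intro i ε hε
          obtain ⟨δ, hδ, hεδ, γ, hγ, hleast⟩ := hg (e i) ε hε
          rw [Function.leftInverse_invFun e.injective i] at hδ hγ
          obtain ⟨⟨h1, h2, h3⟩, h4, h5, h6, h7⟩ := hB i δ hδ γ hγ hleast.1.2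
          refine ⟨d γ, h1, hεδ.trans h4, hεδ.trans h5, ⟨?_, γ, ⟨⟨hleast.1.1, h6⟩, ?_⟩, Or.inl rfl⟩,
            ⟨?_, γ, ⟨⟨hleast.1.1, h7⟩, ?_⟩, Or.inr rfl⟩⟩
          · rwa [hαn]
          -- The coordinate lies between `δ` and `γ`, so `γ` is also the least element of `C α`
          -- above it.
          · exact fun c hc => hleast.2 ⟨hc.1, lt_trans h4 hc.2⟩
          · rwa [hαn]
          · exact fun c hc => hleast.2 ⟨hc.1, lt_trans h5 hc.2⟩
        refine ⟨α, ⟨hαS, fun ε hε => ?_⟩, hεα, hαn, hcap⟩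
        -- Capturing a single family already makes the ladder cofinal, which puts α in `T`; this
        -- needs `ι` nonempty.
        obtain ⟨p, -, h1, -, h2, -⟩ := hcap (Classical.arbitrary ι) ε hε
        exact ⟨p.1, h2, h1⟩
      exists_level := by
        intro n ε
        obtain ⟨α, hα, hεα, -⟩ := hh n (fun _ => Set.univ) (fun _ => IsCofinal.univ) ε
        exact ⟨α, hεα, hα.2.ge⟩ }
  refine ⟨T, L, fun α hα => hα.1, ⟨fun α => codedLadder_subset (hclub α α.2), ?_, ?_⟩,
    H.isDowkerSpace, H.normalSpace_prod_self⟩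
  · intro α β hβ
    obtain ⟨x, hx, hβx⟩ := α.2.2 β hβ
    exact ⟨x, hx, hβx.le⟩
  · intro α
    rw [show Order.cof (Iio (α : (Order.succ μ).ord.ToType)) = μ from α.2.1]
    exact typeLT_codedLadder hω (hclub α α.2) (htype α α.2) α.2.1 α.2.2
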